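/- Let $\mathbb{D}=\{z\in\mathbb{C}:|z|<1\}$. For functions $h,g$ on $\mathbb{D}$ write $h\prec g$ ($h$ is subordinate to $g$) if there is an analytic function $w$ on $\mathbb{D}$ with $w(0)=0$ and $|w(z)|\le |z|$ such that $h(z)=g(w(z))$ for all $z\in\mathbb{D}$. Let $r_0$ ($\approx 0.546302$) be the positive root of the equation $r^2+2\cot(1)\,r-1=0$. Let $m,k$ be real numbers with $k\ge m\ge 2$, and let $\alpha_1,\alpha_2,\alpha_3>0$ be real numbers with $$\alpha_1-\alpha_2-m^2\alpha_3-3m(k-1)\alpha_3\ \ge\ e\,r_0 .$$ Let $p$ be analytic in $\mathbb{D}$ with $p(0)=1$. If $$1+\alpha_1\,zp'(z)+\alpha_2\,z^2p''(z)+\alpha_3\,z^3p'''(z)\ \prec\ \frac{2}{1+e^{-z}},$$ then $p(z)\prec e^z$. -/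

import Mathlib

/-- A Schwarz function: `w` is analytic in the open unit disc, `w 0 = 0`, and
`|w z| ≤ |z|` for every `z` in the disc. -/
def IsSchwarzFunction (w : ℂ → ℂ) : Prop :=
  AnalyticOnNhd ℂ w (Metric.ball (0 : ℂ) 1) ∧ w 0 = 0 ∧
    ∀ z ∈ Metric.ball (0 : ℂ) 1, ‖w z‖ ≤ ‖z‖

/-- Subordination `h ≺ g` in the open unit disc: `h = g ∘ w` there, for some Schwarz
function `w`. -/
def Subordinate (h g : ℂ → ℂ) : Prop :=
  ∃ w : ℂ → ℂ, IsSchwarzFunction w ∧ ∀ z ∈ Metric.ball (0 : ℂ) 1, h z = g (w z)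

/-! Compare Taylor coefficients. If `p = ∑ aₙ zⁿ`, the differential operator multiplies `aₙ` by `l n
≥ n α₁`, and the hypothesis says that `∑ l n aₙ zⁿ` is `2 / (1 + e^{-w}) - 1 = tanh (w / 2)` for a
Schwarz function `w`, hence bounded by 3/5. Bessel's inequality gives `∑ (n α₁ ‖aₙ‖)² ≤ (3/5)²`, and
Cauchy–Schwarz against `∑ 1/n² = π²/6` gives `‖p - 1‖ ≤ (3/5)(π/√6)/α₁`. Since `α₁ ≥ e r₀ ≥ 1.44`,
this is at most 0.54, so `‖log p‖ < 1`, and the Schwarz lemma makes `log p` the required Schwarz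
function. -/

/-- **Bessel's inequality** for power series bounded on the unit disc. -/
theorem sum_norm_sq_coeff_le_of_norm_le {c : ℕ → ℂ} {f : ℂ → ℂ} {C : ℝ}
    (hf : ∀ z ∈ Metric.ball (0 : ℂ) 1, HasSum (fun n => c n * z ^ n) (f z))
    (hC : ∀ z ∈ Metric.ball (0 : ℂ) 1, ‖f z‖ ≤ C) (M : ℕ) :
    ∑ n ∈ Finset.range M, ‖c n‖ ^ 2 ≤ C ^ 2 := by
  have hC0 : 0 ≤ C := (norm_nonneg _).trans (hC 0 (by simp))
  have key : ∀ r ∈ Set.Ioo (0 : ℝ) 1, ∑ n ∈ Finset.range M, (‖c n‖ * r ^ n) ^ 2 ≤ C ^ 2 := by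
    intro r hr
    have hrz : ∀ z : ℂ, ‖z‖ = 1 → (r : ℂ) * z ∈ Metric.ball (0 : ℂ) 1 := by
      intro z hz
      simp [hz, abs_of_pos hr.1, hr.2]
    have hsum : Summable fun n => ‖c n‖ * r ^ n := by
      have := (hf _ (hrz 1 (by simp))).summable.norm
      simpa [abs_of_pos hr.1] using this
    set ε : ℕ → ℝ := fun N => ∑' n, ‖c (n + N)‖ * r ^ (n + N) with hε
    have hε0 : Filter.Tendsto ε Filter.atTop (nhds 0) :=
      tendsto_sum_nat_add fun n => ‖c n‖ * r ^ n
    have hlim : Filter.Tendsto (fun N => (C + ε N) ^ 2) Filter.atTop (nhds (C ^ 2)) := by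
      simpa using (hε0.const_add C).pow 2
    refine ge_of_tendsto hlim ?_
    filter_upwards [Filter.eventually_ge_atTop M] with N hN
    -- Truncating on the circle of radius `r` costs only the tail `ε N`, so Parseval for polynomials
    -- suffices.
    set P : Polynomial ℂ :=
      ∑ n ∈ Finset.range N, Polynomial.C (c n * (r : ℂ) ^ n) * Polynomial.X ^ n with hP
    have hcoeff : ∀ n < N, P.coeff n = c n * (r : ℂ) ^ n := by
      intro n hn
      simp only [hP, Polynomial.finsetSum_coeff, Polynomial.coeff_C_mul_X_pow]
      simp [hn]
    have heval : ∀ z : ℂ, ‖z‖ = 1 → ‖P.eval z‖ ≤ C + ε N := by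
      intro z hz
      have h1 := hf _ (hrz z hz)
      have h2 := h1.summable.sum_add_tsum_nat_add N
      rw [h1.tsum_eq] at h2
      have h3 : P.eval z = f (r * z) - ∑' n, c (n + N) * ((r : ℂ) * z) ^ (n + N) := by
        rw [← h2, add_sub_cancel_right, hP, Polynomial.eval_finsetSum]
        refine Finset.sum_congr rfl fun n _ => ?_
        simp [mul_pow, mul_assoc]
      have hn : ∀ n, ‖c n * ((r : ℂ) * z) ^ n‖ = ‖c n‖ * r ^ n := by
        intro n
        simp [hz, abs_of_pos hr.1]
      have h4 : ‖∑' n, c (n + N) * ((r : ℂ) * z) ^ (n + N)‖ ≤ ε N := by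
        refine (norm_tsum_le_tsum_norm ?_).trans_eq (tsum_congr fun n => hn _)
        simp_rw [hn]
        exact (summable_nat_add_iff N).2 hsum
      rw [h3]
      exact (norm_sub_le _ _).trans (add_le_add (hC _ (hrz z hz)) h4)
    have hpars := P.sum_sq_norm_coeff_eq_circleAverage
    have havg : Real.circleAverage (fun z => ‖P.eval z‖ ^ 2) 0 1 ≤ (C + ε N) ^ 2 := by
      refine Real.circleAverage_mono_on_of_le_circle ?_ ?_
      · apply ContinuousOn.circleIntegrable'
        fun_prop
      · intro z hz
        have : ‖z‖ = 1 := by simpa using hz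
        exact pow_le_pow_left₀ (norm_nonneg _) (heval z this) 2
    calc ∑ n ∈ Finset.range M, (‖c n‖ * r ^ n) ^ 2
        = ∑ n ∈ Finset.range M, ‖P.coeff n‖ ^ 2 := by
          refine Finset.sum_congr rfl fun n hn => ?_
          rw [hcoeff n ((Finset.mem_range.1 hn).trans_le hN)]
          simp [abs_of_pos hr.1]
      _ ≤ ∑ n ∈ P.support ∪ Finset.range M, ‖P.coeff n‖ ^ 2 :=
          Finset.sum_le_sum_of_subset_of_nonneg Finset.subset_union_right
            fun _ _ _ => by positivity
      _ = ∑ n ∈ P.support, ‖P.coeff n‖ ^ 2 := by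
          refine (Finset.sum_subset Finset.subset_union_left fun n _ hn => ?_).symm
          simp [Polynomial.notMem_support_iff.1 hn]
      _ ≤ (C + ε N) ^ 2 := hpars.trans_le havg
  have hcont : Filter.Tendsto (fun r : ℝ => ∑ n ∈ Finset.range M, (‖c n‖ * r ^ n) ^ 2)
      (nhdsWithin 1 (Set.Iio 1)) (nhds (∑ n ∈ Finset.range M, ‖c n‖ ^ 2)) := by
    have : Continuous fun r : ℝ => ∑ n ∈ Finset.range M, (‖c n‖ * r ^ n) ^ 2 := by fun_prop
    simpa using (this.tendsto 1).mono_left nhdsWithin_le_nhds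
  refine le_of_tendsto hcont ?_
  filter_upwards [Ioo_mem_nhdsLT (zero_lt_one' ℝ)] with r hr using key r hr

/-- The Taylor expansion of `z ^ j * f⁽ʲ⁾(z)` in the unit disc. -/
theorem hasSum_pow_mul_iteratedDeriv {f : ℂ → ℂ}
    (hf : AnalyticOnNhd ℂ f (Metric.ball (0 : ℂ) 1)) (j : ℕ) {z : ℂ}
    (hz : z ∈ Metric.ball (0 : ℂ) 1) :
    HasSum (fun n : ℕ => (n.descFactorial j : ℂ) *
      ((n.factorial : ℂ)⁻¹ * iteratedDeriv n f 0) * z ^ n) (z ^ j * iteratedDeriv j f z) := by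
  have hd : DifferentiableOn ℂ (iteratedDeriv j f) (Metric.ball (0 : ℂ) 1) := by
    rw [iteratedDeriv_eq_iterate]
    exact (hf.iterated_deriv j).differentiableOn
  have h := (Complex.hasSum_taylorSeries_on_ball hd hz).mul_left (z ^ j)
  -- The terms with `n < j` vanish because `n.descFactorial j = 0`.
  rw [← hasSum_nat_add_iff' j, Finset.sum_eq_zero, sub_zero]
  · refine h.congr_fun fun n => ?_
    have hfac : ((n + j).factorial : ℂ) = n.factorial * (n + j).descFactorial j := by
      have := Nat.factorial_mul_descFactorial (Nat.le_add_left j n)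
      rw [Nat.add_sub_cancel] at this
      exact_mod_cast this.symm
    have h1 : (n.factorial : ℂ) ≠ 0 := by exact_mod_cast n.factorial_ne_zero
    have h2 : ((n + j).descFactorial j : ℂ) ≠ 0 := by
      intro h0
      rw [h0, mul_zero] at hfac
      exact (n + j).factorial_ne_zero (by exact_mod_cast hfac)
    have hit : iteratedDeriv n (iteratedDeriv j f) 0 = iteratedDeriv (n + j) f 0 := by
      simp only [iteratedDeriv_eq_iterate, Function.iterate_add_apply]
    rw [hit, hfac]
    simp only [smul_eq_mul, sub_zero]
    field_simp
    ring
  · intro n hn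
    simp [Nat.descFactorial_of_lt (Finset.mem_range.1 hn)]

/-- With `w = 2v` the quantity is `tanh v`, `‖v‖ ≤ 1/2`. Degree-4 Taylor polynomials of `exp (±v)`,
with error at most 1/3200 each, bound the quotient by about 0.598. -/
theorem norm_sigmoid_sub_one_le {w : ℂ} (hw : ‖w‖ ≤ 1) :
    ‖2 / (1 + Complex.exp (-w)) - 1‖ ≤ 3 / 5 := by
  obtain ⟨v, rfl⟩ : ∃ v, w = 2 * v := ⟨w / 2, by ring⟩
  have hv : ‖v‖ ≤ 1 / 2 := by
    rw [norm_mul, Complex.norm_ofNat] at hw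
    linarith
  have hv2 : ‖v‖ ^ 2 ≤ 1 / 4 := by nlinarith [norm_nonneg v]
  have hv3 : ‖v‖ ^ 3 ≤ 1 / 8 := by nlinarith [norm_nonneg v]
  have hv4 : ‖v‖ ^ 4 ≤ 1 / 16 := by nlinarith [norm_nonneg v, sq_nonneg (‖v‖ ^ 2)]
  have hv5 : ‖v‖ ^ 5 ≤ 1 / 32 := by nlinarith [norm_nonneg v, sq_nonneg (‖v‖ ^ 2)]
  have e1 := Complex.exp_bound (x := v) (hv.trans (by norm_num)) (n := 5) (by norm_num)
  have e2 := Complex.exp_bound (x := -v) (by rw [norm_neg]; linarith) (n := 5) (by norm_num)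
  rw [norm_neg] at e2
  set R := Complex.exp v - ∑ m ∈ Finset.range 5, v ^ m / (m.factorial : ℂ) with hR
  set S := Complex.exp (-v) - ∑ m ∈ Finset.range 5, (-v) ^ m / (m.factorial : ℂ) with hS
  norm_num [Nat.factorial] at e1 e2
  have hRn : ‖R‖ ≤ 1 / 3200 := by linarith
  have hSn : ‖S‖ ≤ 1 / 3200 := by linarith
  have hnum : Complex.exp v - Complex.exp (-v) = 2 * v + v ^ 3 / 3 + (R - S) := by
    rw [hR, hS]
    simp only [Finset.sum_range_succ, Finset.sum_range_zero]
    norm_num [Nat.factorial]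
    ring
  have hden : Complex.exp v + Complex.exp (-v) = 2 + (v ^ 2 + v ^ 4 / 12 + (R + S)) := by
    rw [hR, hS]
    simp only [Finset.sum_range_succ, Finset.sum_range_zero]
    norm_num [Nat.factorial]
    ring
  have hRS1 : ‖R - S‖ ≤ 1 / 1600 := (norm_sub_le _ _).trans (by linarith)
  have hRS2 : ‖R + S‖ ≤ 1 / 1600 := (norm_add_le _ _).trans (by linarith)
  have hnumn : ‖Complex.exp v - Complex.exp (-v)‖ ≤ 1 + 1 / 24 + 1 / 1600 := by
    rw [hnum]
    refine (norm_add₃_le).trans ?_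
    rw [norm_mul, norm_div, norm_pow, Complex.norm_ofNat, Complex.norm_ofNat]
    linarith
  have hdenn : 2 - (1 / 4 + 1 / 192 + 1 / 1600) ≤ ‖Complex.exp v + Complex.exp (-v)‖ := by
    rw [hden]
    have h1 : ‖v ^ 2 + v ^ 4 / 12 + (R + S)‖ ≤ 1 / 4 + 1 / 192 + 1 / 1600 := by
      refine (norm_add₃_le).trans ?_
      rw [norm_div, norm_pow, norm_pow, Complex.norm_ofNat]
      linarith
    have h2 := norm_sub_le_norm_add (2 : ℂ) (v ^ 2 + v ^ 4 / 12 + (R + S))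
    rw [Complex.norm_ofNat] at h2
    linarith
  have hne : Complex.exp v + Complex.exp (-v) ≠ 0 := by
    intro h0
    rw [h0, norm_zero] at hdenn
    norm_num at hdenn
  have hexp : Complex.exp (-(2 * v)) * Complex.exp v = Complex.exp (-v) := by
    rw [← Complex.exp_add]
    ring_nf
  have heq : 2 / (1 + Complex.exp (-(2 * v))) - 1 =
      (Complex.exp v - Complex.exp (-v)) / (Complex.exp v + Complex.exp (-v)) := by
    rw [← hexp] at hne ⊢
    have : 1 + Complex.exp (-(2 * v)) ≠ 0 := by
      intro h0
      apply hne
      linear_combination Complex.exp v * h0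
    field_simp
    ring
  rw [heq, norm_div, div_le_iff₀ (norm_pos_iff.2 hne)]
  linarith

/-- The positive root is `tan (1/2)`; the quadratic is still negative at 0.53 because `cot 1 ≤
0.67`. -/
theorem le_of_sq_add_two_cot_one_mul_eq {r : ℝ} (hr : 0 < r)
    (hroot : r ^ 2 + 2 * Real.cot 1 * r - 1 = 0) : 53 / 100 ≤ r := by
  have hc := Real.cos_one_le
  have hc0 := Real.cos_one_pos
  have hs0 : 0 < Real.sin 1 := Real.sin_pos_of_pos_of_lt_pi one_pos (by linarith [Real.pi_gt_three])
  have hs : 83 / 100 ≤ Real.sin 1 := by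
    nlinarith [Real.sin_sq_add_cos_sq 1]
  have hcot : Real.cot 1 ≤ 67 / 100 := by
    rw [Real.cot_eq_cos_div_sin, div_le_iff₀ hs0]
    linarith
  nlinarith

theorem mem_slitPlane_and_norm_log_lt_one {z : ℂ} (hz : ‖z - 1‖ ≤ 27 / 50) :
    z ∈ Complex.slitPlane ∧ ‖Complex.log z‖ < 1 := by
  have hz1 : ‖z - 1‖ < 1 := hz.trans_lt (by norm_num)
  have h := Complex.norm_log_one_add_le hz1
  have hm := Complex.mem_slitPlane_of_norm_lt_one hz1
  rw [add_sub_cancel] at h hm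
  refine ⟨hm, h.trans_lt ?_⟩
  have h2 : (1 - ‖z - 1‖)⁻¹ ≤ 50 / 23 := by
    rw [inv_le_comm₀ (by linarith) (by norm_num)]
    linarith
  have h1 : ‖z - 1‖ ^ 2 ≤ (27 / 50) ^ 2 := pow_le_pow_left₀ (norm_nonneg _) hz 2
  have h3 : ‖z - 1‖ ^ 2 * (1 - ‖z - 1‖)⁻¹ ≤ (27 / 50) ^ 2 * (50 / 23) :=
    mul_le_mul h1 h2 (inv_nonneg.2 (by linarith)) (by norm_num)
  linarith

/-- A function staying within `27 / 50` of `1` on the disc and equal to `1` at the origin is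
subordinate to the exponential. -/
theorem subordinate_exp_of_norm_sub_one_le {p : ℂ → ℂ}
    (hp : AnalyticOnNhd ℂ p (Metric.ball (0 : ℂ) 1)) (hp0 : p 0 = 1)
    (h : ∀ z ∈ Metric.ball (0 : ℂ) 1, ‖p z - 1‖ ≤ 27 / 50) :
    Subordinate p (fun z : ℂ => Complex.exp z) := by
  have hlog : AnalyticOnNhd ℂ (fun z => Complex.log (p z)) (Metric.ball (0 : ℂ) 1) :=
    fun z hz => (hp z hz).clog (mem_slitPlane_and_norm_log_lt_one (h z hz)).1
  have hlog0 : Complex.log (p 0) = 0 := by rw [hp0, Complex.log_one]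
  refine ⟨fun z => Complex.log (p z), ⟨hlog, hlog0, fun z hz => ?_⟩, fun z hz => ?_⟩
  · refine Complex.norm_le_norm_of_mapsTo_ball hlog.differentiableOn (fun y hy => ?_) hlog0
      (by simpa using hz)
    simpa using (mem_slitPlane_and_norm_log_lt_one (h y hy)).2.le
  · exact (Complex.exp_log
      (Complex.slitPlane_ne_zero (mem_slitPlane_and_norm_log_lt_one (h z hz)).1)).symm

/-- If the coefficients of a power series are square summable with sum at most `C ^ 2` after
multiplication by `n * α`, then its values differ from the constant term by a controlled amount. -/
theorem norm_sub_coeff_zero_le {a : ℕ → ℂ} {α C : ℝ} (hα : 0 < α)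
    (h : ∀ M, ∑ n ∈ Finset.range M, (n * α * ‖a n‖) ^ 2 ≤ C ^ 2) {z s : ℂ} (hz : ‖z‖ ≤ 1)
    (hs : HasSum (fun n => a n * z ^ n) s) {B : ℝ} (hB : 0 ≤ B)
    (hCB : C ^ 2 * (Real.pi ^ 2 / 6) ≤ (B * α) ^ 2) : ‖s - a 0‖ ≤ B := by
  have hs' := ((hasSum_nat_add_iff' 1).2 hs).tendsto_sum_nat
  simp only [Finset.sum_range_one, pow_zero, mul_one] at hs'
  refine le_of_tendsto hs'.norm (Filter.Eventually.of_forall fun M => ?_)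
  have hle : ‖∑ n ∈ Finset.range M, a (n + 1) * z ^ (n + 1)‖ * α ≤
      ∑ n ∈ Finset.range M, (1 / ((n + 1 : ℕ) : ℝ)) * ((n + 1 : ℕ) * α * ‖a (n + 1)‖) := by
    rw [← le_div_iff₀ hα, Finset.sum_div]
    refine (norm_sum_le _ _).trans (Finset.sum_le_sum fun n _ => ?_)
    rw [norm_mul, norm_pow]
    have h1 : ‖z‖ ^ (n + 1) ≤ 1 := pow_le_one₀ (norm_nonneg _) hz
    have h2 : (1 / ((n + 1 : ℕ) : ℝ)) * ((n + 1 : ℕ) * α * ‖a (n + 1)‖) / α = ‖a (n + 1)‖ := by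
      field_simp
    rw [h2]
    exact mul_le_of_le_one_right (norm_nonneg _) h1
  have hA : ∑ n ∈ Finset.range M, (1 / ((n + 1 : ℕ) : ℝ)) ^ 2 ≤ Real.pi ^ 2 / 6 := by
    have hz2 := hasSum_zeta_two
    rw [← hz2.tsum_eq]
    refine le_trans ?_ (hz2.summable.sum_le_tsum (Finset.range (M + 1))
      fun _ _ => by positivity)
    rw [Finset.sum_range_succ']
    simp
  have hD : ∑ n ∈ Finset.range M, ((n + 1 : ℕ) * α * ‖a (n + 1)‖) ^ 2 ≤ C ^ 2 := by
    refine le_trans ?_ (h (M + 1))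
    rw [Finset.sum_range_succ']
    simp
  -- Cauchy–Schwarz for the splitting `‖aₙ‖ α = (1/n) · (n α ‖aₙ‖)`.
  have hCS := Finset.sum_mul_sq_le_sq_mul_sq (Finset.range M)
    (fun n => 1 / ((n + 1 : ℕ) : ℝ)) (fun n => ((n + 1 : ℕ) : ℝ) * α * ‖a (n + 1)‖)
  have hprod := mul_le_mul hA hD (Finset.sum_nonneg fun _ _ => by positivity) (by positivity)
  have hfin : ∑ n ∈ Finset.range M, (1 / ((n + 1 : ℕ) : ℝ)) * ((n + 1 : ℕ) * α * ‖a (n + 1)‖)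
      ≤ B * α :=
    abs_le_of_sq_le_sq' (by linarith) (by positivity) |>.2
  exact le_of_mul_le_mul_right (hle.trans hfin) hα

theorem mainTheorem11 (α₁ α₂ α₃ m k r₀ : ℝ)
    (hα₁ : 0 < α₁) (hα₂ : 0 < α₂) (hα₃ : 0 < α₃)
    (hm : 2 ≤ m) (hk : m ≤ k)
    (hr₀ : 0 < r₀) (hroot : r₀ ^ 2 + 2 * Real.cot 1 * r₀ - 1 = 0)
    (hα : Real.exp 1 * r₀ ≤ α₁ - α₂ - m ^ 2 * α₃ - 3 * m * (k - 1) * α₃)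
    (p : ℂ → ℂ) (hp : AnalyticOnNhd ℂ p (Metric.ball (0 : ℂ) 1)) (hp0 : p 0 = 1)
    (hsub : Subordinate
      (fun z : ℂ => 1 + (α₁ : ℂ) * (z * deriv p z) + (α₂ : ℂ) * (z ^ 2 * iteratedDeriv 2 p z)
        + (α₃ : ℂ) * (z ^ 3 * iteratedDeriv 3 p z))
      (fun z : ℂ => 2 / (1 + Complex.exp (-z)))) :
    Subordinate p (fun z : ℂ => Complex.exp z) := by
  obtain ⟨w, ⟨-, -, hw⟩, hsw⟩ := hsub
  have hα₁' : 36 / 25 ≤ α₁ := by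
    have hr := le_of_sq_add_two_cot_one_mul_eq hr₀ hroot
    have he : 1.44 ≤ Real.exp 1 * r₀ := by nlinarith [Real.exp_one_gt_d9]
    have h1 : 0 ≤ m ^ 2 * α₃ := by positivity
    have h2 : 0 ≤ 3 * m * (k - 1) * α₃ :=
      mul_nonneg (mul_nonneg (by linarith) (by linarith)) hα₃.le
    norm_num at he
    linarith
  set a : ℕ → ℂ := fun n => (n.factorial : ℂ)⁻¹ * iteratedDeriv n p 0 with ha
  set l : ℕ → ℝ := fun n => α₁ * n.descFactorial 1 + α₂ * n.descFactorial 2 +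
    α₃ * n.descFactorial 3 with hl
  have hsum : ∀ z ∈ Metric.ball (0 : ℂ) 1, HasSum (fun n => ((l n : ℝ) * a n) * z ^ n)
      (2 / (1 + Complex.exp (-w z)) - 1) := by
    intro z hz
    have h := (((hasSum_pow_mul_iteratedDeriv hp 1 hz).mul_left (α₁ : ℂ)).add
      ((hasSum_pow_mul_iteratedDeriv hp 2 hz).mul_left (α₂ : ℂ))).add
      ((hasSum_pow_mul_iteratedDeriv hp 3 hz).mul_left (α₃ : ℂ))
    have hval := hsw z hz
    simp only at hval
    rw [← hval]
    have hfun : (fun n => ((l n : ℝ) * a n) * z ^ n) = _ := funext fun n => show _ =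
        (α₁ : ℂ) * ((n.descFactorial 1 : ℂ) * a n * z ^ n) +
          α₂ * ((n.descFactorial 2 : ℂ) * a n * z ^ n) +
          α₃ * ((n.descFactorial 3 : ℂ) * a n * z ^ n) by
      simp only [hl]
      push_cast
      ring
    rw [hfun, add_assoc, add_assoc, add_sub_cancel_left, ← add_assoc]
    simpa only [pow_one, iteratedDeriv_one] using h
  have hbound := sum_norm_sq_coeff_le_of_norm_le hsum (C := 3 / 5) fun z hz =>
    norm_sigmoid_sub_one_le ((hw z hz).trans (by simpa using (Metric.mem_ball.1 hz).le))
  have hcoef : ∀ M, ∑ n ∈ Finset.range M, (n * α₁ * ‖a n‖) ^ 2 ≤ (3 / 5 : ℝ) ^ 2 := by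
    refine fun M => (Finset.sum_le_sum fun n _ => ?_).trans (hbound M)
    -- The `α₂` and `α₃` terms are nonnegative and can be dropped.
    have hln : n * α₁ ≤ l n := by
      have h2 : 0 ≤ α₂ * n.descFactorial 2 := by positivity
      have h3 : 0 ≤ α₃ * n.descFactorial 3 := by positivity
      simp only [hl, Nat.descFactorial_one]
      linarith
    rw [norm_mul (l n : ℂ) (a n), Complex.norm_real]
    refine pow_le_pow_left₀ (by positivity) ?_ 2
    exact mul_le_mul_of_nonneg_right (hln.trans (le_abs_self _)) (norm_nonneg _)
  refine subordinate_exp_of_norm_sub_one_le hp hp0 fun z hz => ?_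
  have hpz : HasSum (fun n => a n * z ^ n) (p z) := by
    simpa using hasSum_pow_mul_iteratedDeriv hp 0 hz
  have ha0 : a 0 = 1 := by simp [ha, hp0]
  rw [← ha0]
  refine norm_sub_coeff_zero_le hα₁ hcoef (by simpa using (Metric.mem_ball.1 hz).le) hpz
    (by norm_num) ?_
  -- Numerically, `0.36 · 3.15² / 6 ≈ 0.595` against `(0.54 · 1.44)² ≈ 0.605`.
  have h1 : Real.pi ^ 2 ≤ 3.15 ^ 2 := pow_le_pow_left₀ Real.pi_pos.le Real.pi_lt_d2.le 2
  have h2 : (27 / 50 * (36 / 25)) ^ 2 ≤ (27 / 50 * α₁) ^ 2 :=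
    pow_le_pow_left₀ (by norm_num) (by linarith) 2
  norm_num at h1 h2 ⊢
  linarith
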